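/- Consider a downlink rate-splitting system in which a base station at $x_0\in\mathbb R^3$ serves $K$ users, with power fractions $\alpha_{\mathrm c}$ for the common message and $\alpha_{\mathrm p,j}\ge 0$ for the private message of user $j$, $\alpha_{\mathrm c}+\sum_{j=1}^K\alpha_{\mathrm p,j}=1$. Fix a user $k$ at $x_k\neq x_0$, with path loss $L_k=\|x_0-x_k\|^{-\beta}$, $\beta>2$, whose fluid antenna has $N_k\ge 1$ ports with channel coefficients $h^1,\dots,h^{N_k}$ and gains $g^n=|h^n|^2$. Assume Rayleigh fading at every port (each $|h^n|$ is Rayleigh distributed) with common mean gain $\overline g=\mathbb E[g^n]$, and assume that the gains are coupled by the Student-$t$ copula with $\nu_k>0$ degrees of freedom and correlation matrix $\mathbf\Sigma_k$: for all real $s_1,\dots,s_{N_k}$, $$\Pr(g^1\le s_1,\dots,g^{N_k}\le s_{N_k})=T_{\nu_k,\mathbf\Sigma_k}\big(t_{\nu_k}^{-1}(F_{g^1}(s_1)),\dots,t_{\nu_k}^{-1}(F_{g^{N_k}}(s_{N_k}))\big),$$ where $T_{\nu,\mathbf\Sigma}$ is the CDF of the multivariate $t$-distribution (with $\mathbf\Sigma$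 positive semidefinite with unit diagonal), $t_\nu^{-1}$ is the ($[-\infty,\infty]$-valued) quantile function of the univariate $t$-distribution, and $F_{g^n}$ is the CDF of $g^n$. Let $g_{\mathrm{fas}}=\max_n g^n$ and, for average transmit SNR $\overline\gamma>0$, let $$\gamma_{\mathrm c}=\frac{\overline\gamma\,\alpha_{\mathrm c}L_kg_{\mathrm{fas}}}{\overline\gamma(1-\alpha_{\mathrm c})L_kg_{\mathrm{fas}}+1},\qquad \gamma_{\mathrm p}=\frac{\overline\gamma\,\alpha_{\mathrm p,k}L_kg_{\mathrm{fas}}}{\overline\gamma L_kg_{\mathrm{fas}}\sum_{j\ne k}\alpha_{\mathrm p,j}+1}.$$ Let $\gamma_{\mathrm{th,c}},\gamma_{\mathrm{th,p}}>0$ be thresholds with $(1-\alpha_{\mathrm c})\gamma_{\mathrm{th,c}}<\alpha_{\mathrm c}$ and $(1-\alpha_{\mathrm c}-\alpha_{\mathrm p,k})\gamma_{\mathrm{th,p}}<\alpha_{\mathrm p,k}$, let $P_{\mathrm o,k}(\overline\gamma)=1-\Pr(\gamma_{\mathrm c}>\gamma_{\mathrm{th,c}},\ \gamma_{\mathrm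 p}>\gamma_{\mathrm{th,p}})$ be the outage probability, and put $$\gamma_{\mathrm{th}}(\overline\gamma)=\max\Big\{\frac{\gamma_{\mathrm{th,c}}}{\overline\gamma L_k(\alpha_{\mathrm c}-(1-\alpha_{\mathrm c})\gamma_{\mathrm{th,c}})},\ \frac{\gamma_{\mathrm{th,p}}}{\overline\gamma L_k(\alpha_{\mathrm p,k}-(1-\alpha_{\mathrm c}-\alpha_{\mathrm p,k})\gamma_{\mathrm{th,p}})}\Big\}.$$ Then, for every $\overline\gamma>0$, $$P_{\mathrm o,k}(\overline\gamma)=T_{\nu_k,\mathbf\Sigma_k}\big(t_{\nu_k}^{-1}(1-e^{-\gamma_{\mathrm{th}}(\overline\gamma)/\overline g}),\dots,t_{\nu_k}^{-1}(1-e^{-\gamma_{\mathrm{th}}(\overline\gamma)/\overline g})\big),$$ and, as $\overline\gamma\to\infty$, one has $F_{g^n}(\gamma_{\mathrm{th}}(\overline\gamma))\sim\gamma_{\mathrm{th}}(\overline\gamma)/\overline g$ for every $n$, and $$P_{\mathrm o,k}(\overline\gamma)\sim P_{\mathrm o,k}^\infty(\overline\gamma):=T_{\nu_k,\mathbf\Sigma_k}\big(t_{\nu_k}^{-1}(\gamma_{\mathrm{th}}(\overline\gamma)/\overline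 g),\dots,t_{\nu_k}^{-1}(\gamma_{\mathrm{th}}(\overline\gamma)/\overline g)\big).$$ Here $a\sim b$ means $a-b=o(b)$, i.e. $a/b\to1$ wherever $b\ne0$ (and $a=0$ where $b=0$, for all large $\overline\gamma$). -/

import Mathlib

open MeasureTheory ProbabilityTheory Filter Asymptotics

/-! ### Student's `t` distribution and the `t` copula -/

noncomputable section

/-- The chi-square distribution with `ν` degrees of freedom, that is, the gamma distribution of
shape `ν / 2` and rate `1 / 2`. -/
def chiSquareMeasure (ν : ℝ) : Measure ℝ := gammaMeasure (ν / 2) (1 / 2)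

/-- The univariate Student `t` distribution with `ν` degrees of freedom: the law of `Z / √(W / ν)`
for independent `Z ∼ N(0, 1)` and `W ∼ χ²(ν)`. -/
def studentTMeasure (ν : ℝ) : Measure ℝ :=
  ((gaussianReal 0 1).prod (chiSquareMeasure ν)).map fun p => p.1 / √(p.2 / ν)

/-- The `N`-variate (centred) `t` distribution with `ν` degrees of freedom and matrix `S`: the law
of `Z / √(W / ν)` for independent `Z ∼ N(0, S)` and `W ∼ χ²(ν)`. -/
def multivariateTMeasure {N : ℕ} (ν : ℝ) (S : Matrix (Fin N) (Fin N) ℝ) :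
    Measure (Fin N → ℝ) :=
  ((multivariateGaussian 0 S).prod (chiSquareMeasure ν)).map fun p i => p.1 i / √(p.2 / ν)

/-- The quantile function (inverse distribution function) of the univariate `t` distribution, with
values in the extended reals: it is `⊥` at `0` and `⊤` at `1`. -/
def tQuantile (ν p : ℝ) : EReal :=
  sInf {y : EReal | ∃ x : ℝ, y = x ∧ p ≤ (studentTMeasure ν).real (Set.Iic x)}

/-- The distribution function of the multivariate `t` distribution, on the extended reals. -/
def multivariateTCDF {N : ℕ} (ν : ℝ) (S : Matrix (Fin N) (Fin N) ℝ) (x : Fin N → EReal) : ℝ :=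
  (multivariateTMeasure ν S).real {y | ∀ i, (y i : EReal) ≤ x i}

/-- The Student `t` copula. -/
def tCopula {N : ℕ} (ν : ℝ) (S : Matrix (Fin N) (Fin N) ℝ) (u : Fin N → ℝ) : ℝ :=
  multivariateTCDF ν S fun i => tQuantile ν (u i)

/-- Correlation matrices: positive semidefinite (in particular symmetric) with unit diagonal. -/
def IsCorrelationMatrix {N : ℕ} (S : Matrix (Fin N) (Fin N) ℝ) : Prop :=
  S.PosSemidef ∧ ∀ i, S i i = 1

/-- The random variables `X 1, …, X N` are coupled by the `t` copula: their joint distribution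
function is the copula evaluated at their marginal distribution functions. -/
def HasTCopula {Ω : Type*} [MeasurableSpace Ω] (P : Measure Ω) {N : ℕ} (ν : ℝ)
    (S : Matrix (Fin N) (Fin N) ℝ) (X : Fin N → Ω → ℝ) : Prop :=
  ∀ s : Fin N → ℝ,
    P.real {ω | ∀ i, X i ω ≤ s i} = tCopula ν S fun i => P.real {ω | X i ω ≤ s i}

/-! ### Rayleigh fading -/

/-- The Rayleigh distribution of scale `σ`. -/
def rayleighMeasure (σ : ℝ) : Measure ℝ :=
  volume.withDensity fun r =>
    ENNReal.ofReal (if 0 ≤ r then r / σ ^ 2 * Real.exp (-r ^ 2 / (2 * σ ^ 2)) else 0)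

/-- The complex channel coefficient `h` undergoes Rayleigh fading: its modulus is Rayleigh
distributed. -/
def IsRayleighFading {Ω : Type*} [MeasurableSpace Ω] (P : Measure Ω) (h : Ω → ℂ) : Prop :=
  ∃ σ : ℝ, 0 < σ ∧ HasLaw (fun ω => ‖h ω‖) (rayleighMeasure σ) P

/-! ### Fluid antenna system with rate splitting -/

/-- The channel gain of a port with channel coefficient `h`. -/
def channelGain {Ω : Type*} (h : Ω → ℂ) (ω : Ω) : ℝ := ‖h ω‖ ^ 2

/-- The equivalent channel gain of a fluid antenna: the gain of the best port. -/
def fasGain {Ω : Type*} {N : ℕ} [NeZero N] (h : Fin N → Ω → ℂ) (ω : Ω) : ℝ :=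
  Finset.univ.sup' Finset.univ_nonempty fun n => channelGain (h n) ω

/-- Path loss between a base station at `x₀` and a user at `x`, with exponent `β`. -/
def pathLoss (β : ℝ) (x₀ x : EuclideanSpace ℝ (Fin 3)) : ℝ := dist x₀ x ^ (-β)

/-- SINR of the common message at average transmit SNR `snr`, path loss `L`, channel gain `g`. -/
def sinrCommon (αc L snr g : ℝ) : ℝ :=
  snr * αc * L * g / (snr * (1 - αc) * L * g + 1)

/-- SINR of the private message of user `k` after the common message has been removed. -/
def sinrPrivate {K : ℕ} (αp : Fin K → ℝ) (k : Fin K) (L snr g : ℝ) : ℝ :=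
  snr * αp k * L * g / (snr * L * g * (∑ j ∈ Finset.univ.erase k, αp j) + 1)

/-- Outage probability of user `k` with port channels `h`: the probability that it is not true that
both SINRs exceed their thresholds `θc` (common message) and `θp` (private message). -/
def outageProb {Ω : Type*} [MeasurableSpace Ω] (P : Measure Ω) {K N : ℕ} [NeZero N]
    (αc : ℝ) (αp : Fin K → ℝ) (k : Fin K) (L θc θp : ℝ) (h : Fin N → Ω → ℂ) (snr : ℝ) : ℝ :=
  1 - P.real {ω | θc < sinrCommon αc L snr (fasGain h ω) ∧
    θp < sinrPrivate αp k L snr (fasGain h ω)}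

/-- The threshold for the channel gain that is equivalent to the two SINR thresholds. -/
def gainThreshold (αc αpk L θc θp snr : ℝ) : ℝ :=
  max (θc / (snr * L * (αc - (1 - αc) * θc)))
    (θp / (snr * L * (αpk - (1 - αc - αpk) * θp)))

end

/-!
Since the gains are nonnegative, no outage means that the best gain exceeds `gainThreshold`, so the
outage probability is the diagonal of the copula at the exponential marginal `1 - exp (-x)`, which
is equivalent to `x`. It remains to see that `C p`, the copula at `(p, …, p)`, turns equivalent
small arguments into equivalent values. Nothing like regular variation of `C` is available: `C` may
even vanish, for instance when two coordinates are perfectly anticorrelated.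

The substitute is a monotonicity. The density of the gamma distribution of shape `a` and rate `s`,
divided by `s ^ a`, decreases in `s`; hence `r ^ ν` times the law of `r √(W / ν)`, `W ∼ χ²(ν)`,
increases with `r`, and so do `r ^ ν Pr(T ≤ -r)` and `r ^ ν Pr(T₁ ≤ -r, …, T_N ≤ -r)`. The first is
bounded because `Pr(W ≤ w) = O(w ^ (ν / 2))`, so it converges to some `ℓ > 0`, which says that the
level `r p` with `Pr(T ≤ -r p) = p` satisfies `(r p) ^ ν ∼ ℓ / p`. The second says that
`(r p) ^ ν * C p` decreases while `C p` increases, whence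
`|C q - C p| ≤ |(r p / r q) ^ ν - 1| * C p`, and for equivalent `p, q → 0` the factor tends to `0`.
-/

open scoped Topology

section Gamma

theorem measurable_gammaPDF (a r : ℝ) : Measurable (gammaPDF a r) :=
  (measurable_gammaPDFReal a r).ennreal_ofReal

theorem gammaMeasure_map_const_mul {a r c : ℝ} (hr : 0 ≤ r) (hc : 0 < c) :
    (gammaMeasure a r).map (c * ·) = gammaMeasure a (r / c) := by
  have hscale (t : ℝ) : gammaPDF a r t = ENNReal.ofReal c * gammaPDF a (r / c) (c * t) := by
    rcases lt_or_ge t 0 with ht | ht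
    · rw [gammaPDF_of_neg ht, gammaPDF_of_neg (mul_neg_of_pos_of_neg hc ht), mul_zero]
    · rw [gammaPDF_of_nonneg ht, gammaPDF_of_nonneg (by positivity), ← ENNReal.ofReal_mul hc.le,
        Real.div_rpow hr hc.le, Real.mul_rpow hc.le ht, Real.rpow_sub_one hc.ne']
      have := Real.rpow_pos_of_pos hc a
      field_simp
  ext s hs
  have hs' : MeasurableSet ((c * ·) ⁻¹' s) := hs.preimage (measurable_const_mul c)
  calc (gammaMeasure a r).map (c * ·) s
      = ∫⁻ t, ENNReal.ofReal c * s.indicator (gammaPDF a (r / c)) (c * t) := by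
        rw [Measure.map_apply (measurable_const_mul c) hs, gammaMeasure, withDensity_apply _ hs',
          ← lintegral_indicator hs']
        refine lintegral_congr fun t => ?_
        by_cases ht : c * t ∈ s <;> simp [Set.indicator, ht, hscale t]
    _ = ∫⁻ t, s.indicator (gammaPDF a (r / c)) t := by
        conv_rhs => rw [← Real.smul_map_volume_mul_left hc.ne', abs_of_pos hc]
        have hpdf := (measurable_gammaPDF a (r / c)).indicator hs
        rw [lintegral_smul_measure, lintegral_map hpdf (measurable_const_mul c), smul_eq_mul]
        exact lintegral_const_mul _ (hpdf.comp (measurable_const_mul c))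
    _ = gammaMeasure a (r / c) s := by
        rw [lintegral_indicator hs, gammaMeasure, withDensity_apply _ hs]

theorem antitoneOn_rpow_neg_smul_gammaMeasure {a : ℝ} (ha : 0 < a) :
    AntitoneOn (fun r : ℝ => ENNReal.ofReal (r ^ (-a)) • gammaMeasure a r) (Set.Ioi 0) := by
  intro r hr s hs hrs
  have hpdf {q : ℝ} (hq : 0 < q) {t : ℝ} (ht : 0 ≤ t) :
      ENNReal.ofReal (q ^ (-a)) * gammaPDF a q t =
        ENNReal.ofReal (t ^ (a - 1) / Real.Gamma a * Real.exp (-(q * t))) := by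
    rw [gammaPDF_of_nonneg ht, ← ENNReal.ofReal_mul (by positivity), Real.rpow_neg hq.le]
    have := Real.rpow_pos_of_pos hq a
    field_simp
  simp only [gammaMeasure]
  rw [← withDensity_smul _ (measurable_gammaPDF a s),
    ← withDensity_smul _ (measurable_gammaPDF a r)]
  refine withDensity_mono (ae_of_all _ fun t => ?_)
  simp only [Pi.smul_apply, smul_eq_mul]
  rcases lt_or_ge t 0 with ht | ht
  · simp only [gammaPDF_of_neg ht, mul_zero, le_refl]
  · rw [hpdf hr ht, hpdf hs ht]
    have := Real.Gamma_pos_of_pos ha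
    gcongr

theorem gammaMeasure_Iic_le {a r x : ℝ} (ha : 0 < a) (hr : 0 ≤ r) (hx : 0 ≤ x) :
    gammaMeasure a r (Set.Iic x) ≤ ENNReal.ofReal ((r * x) ^ a / Real.Gamma (a + 1)) := by
  have := Real.Gamma_pos_of_pos ha
  have hint : IntegrableOn (fun t : ℝ => r ^ a / Real.Gamma a * t ^ (a - 1)) (Set.Ioc 0 x) :=
    ((intervalIntegrable_iff_integrableOn_Ioc_of_le hx).1
      (intervalIntegral.intervalIntegrable_rpow' (by linarith))).const_mul _
  calc gammaMeasure a r (Set.Iic x)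
      = ∫⁻ t in Set.Ioc 0 x, gammaPDF a r t := by
        rw [gammaMeasure, withDensity_apply _ measurableSet_Iic,
          lintegral_Iic_eq_lintegral_Iio_add_Icc _ hx, lintegral_gammaPDF_of_nonpos le_rfl,
          zero_add, Measure.restrict_congr_set Ioc_ae_eq_Icc.symm]
    _ ≤ ∫⁻ t in Set.Ioc 0 x, ENNReal.ofReal (r ^ a / Real.Gamma a * t ^ (a - 1)) := by
        refine setLIntegral_mono' measurableSet_Ioc fun t ht => ?_
        have := ht.1
        rw [gammaPDF_of_nonneg ht.1.le]
        refine ENNReal.ofReal_le_ofReal (mul_le_of_le_one_right (by positivity) ?_)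
        exact Real.exp_le_one_iff.2 (neg_nonpos.2 (by positivity))
    _ = ENNReal.ofReal (∫ t in Set.Ioc 0 x, r ^ a / Real.Gamma a * t ^ (a - 1)) := by
        refine (ofReal_integral_eq_lintegral_ofReal hint ?_).symm
        filter_upwards [ae_restrict_mem measurableSet_Ioc] with t ht
        have := ht.1
        positivity
    _ = ENNReal.ofReal ((r * x) ^ a / Real.Gamma (a + 1)) := by
        rw [integral_const_mul, ← intervalIntegral.integral_of_le hx,
          integral_rpow (.inl (by linarith)), sub_add_cancel, Real.zero_rpow ha.ne',
          Real.Gamma_add_one ha.ne', Real.mul_rpow hr hx]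
        congr 1
        field_simp
        ring

theorem ae_gammaMeasure_pos (a r : ℝ) : ∀ᵐ t ∂gammaMeasure a r, 0 < t := by
  simp only [ae_iff, not_lt]
  change gammaMeasure a r (Set.Iic 0) = 0
  rw [gammaMeasure, withDensity_apply _ measurableSet_Iic,
    Measure.restrict_congr_set Iio_ae_eq_Iic.symm]
  exact lintegral_gammaPDF_of_nonpos le_rfl

theorem integral_id_gammaMeasure {a r : ℝ} (ha : 0 < a) (hr : 0 < r) :
    ∫ x, x ∂gammaMeasure a r = a / r := by
  have hdensity : (fun x => (gammaPDF a r x).toReal • x) = (Set.Ioi 0).indicator fun x =>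
      r ^ a / Real.Gamma a * (x ^ (a + 1 - 1) * Real.exp (-(r * x))) := by
    ext x
    rcases lt_trichotomy x 0 with hx | rfl | hx
    · simp [gammaPDF_of_neg hx, hx.not_gt]
    · simp
    · have := Real.Gamma_pos_of_pos ha
      rw [Set.indicator_of_mem (Set.mem_Ioi.2 hx), gammaPDF_of_nonneg hx.le,
        ENNReal.toReal_ofReal (by positivity), add_sub_cancel_right, Real.rpow_sub_one hx.ne',
        smul_eq_mul]
      field_simp
  rw [gammaMeasure, integral_withDensity_eq_integral_toReal_smul
    (measurable_gammaPDF a r) (ae_of_all _ fun _ => ENNReal.ofReal_lt_top),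
    hdensity, integral_indicator measurableSet_Ioi, integral_const_mul,
    Real.integral_rpow_mul_exp_neg_mul_Ioi (by positivity) hr, Real.Gamma_add_one ha.ne',
    one_div, Real.inv_rpow hr.le, Real.rpow_add_one hr.ne']
  have := Real.Gamma_pos_of_pos ha
  have := Real.rpow_pos_of_pos hr a
  field_simp

end Gamma

section Rayleigh

theorem rayleighMeasure_map_sq (σ : ℝ) :
    (rayleighMeasure σ).map (· ^ 2) = expMeasure (2 * σ ^ 2)⁻¹ := by
  set f : ℝ → ENNReal := fun r =>
    ENNReal.ofReal (if 0 ≤ r then r / σ ^ 2 * Real.exp (-r ^ 2 / (2 * σ ^ 2)) else 0) with hf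
  have hf_meas : Measurable f :=
    (Measurable.ite measurableSet_Ici (by fun_prop) measurable_const).ennreal_ofReal
  have himage : (fun r : ℝ => r ^ 2) '' Set.Ici 0 = Set.Ici 0 := by
    refine Set.Subset.antisymm ?_ fun x hx => ⟨√x, Real.sqrt_nonneg x, Real.sq_sqrt hx⟩
    rintro _ ⟨r, -, rfl⟩
    exact sq_nonneg r
  have hpdf {r : ℝ} (hr : 0 ≤ r) :
      f r = ENNReal.ofReal (2 * r) * exponentialPDF (2 * σ ^ 2)⁻¹ (r ^ 2) := by
    rw [exponentialPDF_of_nonneg (sq_nonneg r), ← ENNReal.ofReal_mul (by positivity)]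
    simp only [hf, if_pos hr, div_eq_inv_mul, mul_inv]
    ring_nf
  refine Measure.ext_of_lintegral _ fun g hg => ?_
  calc ∫⁻ x, g x ∂(rayleighMeasure σ).map (· ^ 2)
      = ∫⁻ r, f r * g (r ^ 2) := by
        rw [lintegral_map hg (by fun_prop), rayleighMeasure,
          lintegral_withDensity_eq_lintegral_mul _ hf_meas (by fun_prop)]
        rfl
    _ = ∫⁻ r in Set.Ici 0,
          ENNReal.ofReal (2 * r) * (exponentialPDF (2 * σ ^ 2)⁻¹ (r ^ 2) * g (r ^ 2)) := by
        rw [← setLIntegral_eq_of_support_subset (s := Set.Ici 0)]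
        · exact setLIntegral_congr_fun measurableSet_Ici fun r hr => by
            simp only [hpdf hr, mul_assoc]
        · refine Function.support_subset_iff'.2 fun r hr => ?_
          simp [hf, Set.mem_Ici.not.1 hr]
    _ = ∫⁻ x in Set.Ici 0, exponentialPDF (2 * σ ^ 2)⁻¹ x * g x := by
        conv_rhs => rw [← himage]
        refine (lintegral_image_eq_lintegral_deriv_mul_of_monotoneOn (f := (· ^ 2))
          (f' := (2 * ·)) measurableSet_Ici (fun r _ => ?_)
          (fun r hr s _ hrs => pow_le_pow_left₀ hr hrs 2)
          fun x => exponentialPDF (2 * σ ^ 2)⁻¹ x * g x).symm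
        simpa using (hasDerivAt_pow 2 r).hasDerivWithinAt
    _ = ∫⁻ x, g x ∂expMeasure (2 * σ ^ 2)⁻¹ := by
        rw [setLIntegral_eq_of_support_subset]
        · exact (lintegral_withDensity_eq_lintegral_mul _ (measurable_gammaPDF _ _) hg).symm
        · refine Function.support_subset_iff'.2 fun x hx => ?_
          rw [exponentialPDF_of_neg (not_le.1 hx), zero_mul]

variable {Ω : Type*} [MeasurableSpace Ω] {P : Measure Ω} {h : Ω → ℂ}

theorem IsRayleighFading.exists_hasLaw_channelGain (hh : IsRayleighFading P h) :
    ∃ m : ℝ, 0 < m ∧ HasLaw (channelGain h) (expMeasure m⁻¹) P ∧ ∫ ω, channelGain h ω ∂P = m := by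
  obtain ⟨σ, hσ, hlaw⟩ := hh
  have hgain : HasLaw (channelGain h) (expMeasure (2 * σ ^ 2)⁻¹) P :=
    HasLaw.comp ⟨by fun_prop, rayleighMeasure_map_sq σ⟩ hlaw
  refine ⟨2 * σ ^ 2, by positivity, hgain, ?_⟩
  rw [hgain.integral_eq, expMeasure, integral_id_gammaMeasure one_pos (by positivity), one_div,
    inv_inv]

theorem IsRayleighFading.integral_channelGain_pos (hh : IsRayleighFading P h) :
    0 < ∫ ω, channelGain h ω ∂P := by
  obtain ⟨m, hm, -, hmean⟩ := hh.exists_hasLaw_channelGain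
  rwa [hmean]

theorem IsRayleighFading.hasLaw_channelGain (hh : IsRayleighFading P h) :
    HasLaw (channelGain h) (expMeasure (∫ ω, channelGain h ω ∂P)⁻¹) P := by
  obtain ⟨m, -, hlaw, hmean⟩ := hh.exists_hasLaw_channelGain
  rwa [hmean]

theorem IsRayleighFading.real_channelGain_le (hh : IsRayleighFading P h) {s : ℝ} (hs : 0 ≤ s) :
    P.real {ω | channelGain h ω ≤ s} = 1 - Real.exp (-(s / ∫ ω, channelGain h ω ∂P)) := by
  have hrate := inv_pos.2 hh.integral_channelGain_pos
  have := isProbabilityMeasure_expMeasure hrate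
  rw [hh.hasLaw_channelGain.measureReal_eq (p := (· ≤ s)) measurableSet_Iic]
  change (expMeasure _).real (Set.Iic s) = _
  rw [← cdf_eq_real, cdf_expMeasure_eq hrate, if_pos hs, div_eq_inv_mul]

end Rayleigh

section RateSplitting

theorem pathLoss_pos (β : ℝ) {x₀ x : EuclideanSpace ℝ (Fin 3)} (hx : x₀ ≠ x) :
    0 < pathLoss β x₀ x :=
  Real.rpow_pos_of_pos (dist_pos.2 hx) _

theorem fasGain_nonneg {Ω : Type*} {N : ℕ} [NeZero N] (h : Fin N → Ω → ℂ) (ω : Ω) :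
    0 ≤ fasGain h ω :=
  (sq_nonneg ‖h 0 ω‖).trans
    (Finset.le_sup' (fun n => channelGain (h n) ω) (Finset.mem_univ 0))

theorem fasGain_le_iff {Ω : Type*} {N : ℕ} [NeZero N] {h : Fin N → Ω → ℂ} {ω : Ω} {s : ℝ} :
    fasGain h ω ≤ s ↔ ∀ n, channelGain (h n) ω ≤ s := by
  simp [fasGain]

theorem lt_mul_div_mul_add_one_iff {𝕜 : Type*} [Field 𝕜] [LinearOrder 𝕜] [IsStrictOrderedRing 𝕜]
    {a b c g θ : 𝕜} (hb : 0 ≤ b) (hc : 0 < c) (hg : 0 ≤ g) (hθ : b * θ < a) :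
    θ < c * a * g / (c * b * g + 1) ↔ θ / (c * (a - b * θ)) < g := by
  rw [lt_div_iff₀ (by positivity), div_lt_iff₀ (mul_pos hc (sub_pos.2 hθ))]
  constructor <;> intro h <;> linarith

variable {K : ℕ} {αc : ℝ} {αp : Fin K → ℝ} {k : Fin K} {L θc θp snr : ℝ}

theorem sinr_gt_iff_gainThreshold_lt {g : ℝ} (hαp : ∀ j, 0 ≤ αp j) (hα : αc + ∑ j, αp j = 1)
    (hL : 0 < L) (hfc : (1 - αc) * θc < αc) (hfp : (1 - αc - αp k) * θp < αp k)
    (hsnr : 0 < snr) (hg : 0 ≤ g) :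
    (θc < sinrCommon αc L snr g ∧ θp < sinrPrivate αp k L snr g) ↔
      gainThreshold αc (αp k) L θc θp snr < g := by
  have hsum : ∑ j ∈ Finset.univ.erase k, αp j = 1 - αc - αp k := by
    rw [← Finset.add_sum_erase _ _ (Finset.mem_univ k)] at hα
    linarith
  have hinterf : 0 ≤ 1 - αc - αp k := hsum ▸ Finset.sum_nonneg fun j _ => hαp j
  have hprivate : 0 ≤ 1 - αc := by linarith [hαp k]
  have hc : 0 < snr * L := mul_pos hsnr hL
  rw [gainThreshold, max_lt_iff, ← lt_mul_div_mul_add_one_iff hprivate hc hg hfc,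
    ← lt_mul_div_mul_add_one_iff hinterf hc hg hfp, sinrCommon, sinrPrivate, hsum]
  ring_nf

theorem outageProb_eq_real_forall_channelGain_le {Ω : Type*} [MeasurableSpace Ω] {P : Measure Ω}
    [IsProbabilityMeasure P] {N : ℕ} [NeZero N] {h : Fin N → Ω → ℂ}
    (hmeas : ∀ n, AEMeasurable (channelGain (h n)) P)
    (hαp : ∀ j, 0 ≤ αp j) (hα : αc + ∑ j, αp j = 1) (hL : 0 < L)
    (hfc : (1 - αc) * θc < αc) (hfp : (1 - αc - αp k) * θp < αp k) (hsnr : 0 < snr) :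
    outageProb P αc αp k L θc θp h snr =
      P.real {ω | ∀ n, channelGain (h n) ω ≤ gainThreshold αc (αp k) L θc θp snr} := by
  have hset : {ω | θc < sinrCommon αc L snr (fasGain h ω) ∧
      θp < sinrPrivate αp k L snr (fasGain h ω)} =
      {ω | ∀ n, channelGain (h n) ω ≤ gainThreshold αc (αp k) L θc θp snr}ᶜ := by
    ext ω
    rw [Set.mem_compl_iff, Set.mem_ofPred_eq, Set.mem_ofPred_eq, ← fasGain_le_iff, not_le]
    exact sinr_gt_iff_gainThreshold_lt hαp hα hL hfc hfp hsnr (fasGain_nonneg h ω)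
  rw [outageProb, hset, probReal_compl_eq_one_sub₀, sub_sub_cancel]
  rw [Set.ofPred_forall]
  exact .iInter fun n => nullMeasurableSet_le (hmeas n) aemeasurable_const

variable {αpk : ℝ}

theorem gainThreshold_eq_div (hsnr : 0 ≤ snr) :
    gainThreshold αc αpk L θc θp snr = gainThreshold αc αpk L θc θp 1 / snr := by
  rw [gainThreshold, gainThreshold, ← max_div_div_right hsnr]
  congr 1 <;> rw [one_mul, div_div] <;> congr 1 <;> ring

theorem gainThreshold_pos (hL : 0 < L) (hθc : 0 < θc) (hfc : (1 - αc) * θc < αc)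
    (hsnr : 0 < snr) : 0 < gainThreshold αc αpk L θc θp snr :=
  lt_max_of_lt_left (div_pos hθc (mul_pos (mul_pos hsnr hL) (sub_pos.2 hfc)))

theorem tendsto_gainThreshold_div_atTop {m : ℝ} (hL : 0 < L) (hθc : 0 < θc)
    (hfc : (1 - αc) * θc < αc) (hm : 0 < m) :
    Tendsto (fun snr => gainThreshold αc αpk L θc θp snr / m) atTop (𝓝[>] 0) := by
  refine tendsto_nhdsWithin_iff.2 ⟨?_, (eventually_gt_atTop 0).mono fun snr hsnr =>
    div_pos (gainThreshold_pos hL hθc hfc hsnr) hm⟩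
  have hlim : Tendsto (fun snr => gainThreshold αc αpk L θc θp 1 / snr / m) atTop (𝓝 0) := by
    simpa using (tendsto_const_nhds.div_atTop tendsto_id).div_const m
  refine hlim.congr' ((eventually_ge_atTop 0).mono fun snr hsnr => ?_)
  rw [← gainThreshold_eq_div hsnr]

end RateSplitting

section Exponential

theorem isEquivalent_one_sub_exp_neg : (fun u : ℝ => 1 - Real.exp (-u)) ~[𝓝 0] id := by
  have hderiv : HasDerivAt (fun u : ℝ => 1 - Real.exp (-u)) 1 0 := by
    simpa using (hasDerivAt_neg (0 : ℝ)).exp.const_sub 1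
  simpa [IsEquivalent, Pi.sub_def, Function.id_def] using hasDerivAt_iff_isLittleO.1 hderiv

theorem tendsto_one_sub_exp_neg : Tendsto (fun u : ℝ => 1 - Real.exp (-u)) (𝓝[>] 0) (𝓝[>] 0) := by
  refine tendsto_nhdsWithin_iff.2 ⟨?_, ?_⟩
  · exact isEquivalent_one_sub_exp_neg.symm.tendsto_nhds tendsto_id |>.mono_left nhdsWithin_le_nhds
  · filter_upwards [self_mem_nhdsWithin] with u hu
    exact sub_pos.2 (Real.exp_lt_one_iff.2 (neg_lt_zero.2 hu))

end Exponential

section ChiSquare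

variable {ν : ℝ}

theorem isProbabilityMeasure_chiSquareMeasure (hν : 0 < ν) :
    IsProbabilityMeasure (chiSquareMeasure ν) :=
  isProbabilityMeasure_gammaMeasure (half_pos hν) one_half_pos

theorem monotoneOn_rpow_smul_chiSquareMeasure_map_sqrt (hν : 0 < ν) :
    MonotoneOn (fun r : ℝ => ENNReal.ofReal (r ^ ν) •
      (chiSquareMeasure ν).map fun w => r * √(w / ν)) (Set.Ioi 0) := by
  have hscale {r : ℝ} (hr : 0 < r) : (chiSquareMeasure ν).map (fun w => r * √(w / ν)) =
      (gammaMeasure (ν / 2) (1 / 2 / r ^ 2)).map fun w => √(w / ν) := by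
    rw [chiSquareMeasure, ← gammaMeasure_map_const_mul one_half_pos.le (sq_pos_of_pos hr),
      Measure.map_map (by fun_prop) (by fun_prop)]
    congr 1 with w
    rw [Function.comp_apply, mul_div_assoc, Real.sqrt_mul (sq_nonneg r), Real.sqrt_sq hr.le]
  have hpow {r : ℝ} (hr : 0 < r) :
      r ^ ν = (1 / 2) ^ (ν / 2) * (1 / 2 / r ^ 2) ^ (-(ν / 2)) := by
    rw [Real.rpow_neg (by positivity), ← Real.inv_rpow (by positivity),
      ← Real.mul_rpow (by positivity) (by positivity),
      show 1 / 2 * (1 / 2 / r ^ 2)⁻¹ = r ^ 2 by field_simp, ← Real.rpow_natCast,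
      ← Real.rpow_mul hr.le, Nat.cast_two, mul_div_cancel₀ _ two_ne_zero]
  intro r hr s hs hrs
  have hr0 : 0 < r := hr
  have hs0 : 0 < s := hs
  have hmono := antitoneOn_rpow_neg_smul_gammaMeasure (half_pos hν)
    (Set.mem_Ioi.2 (by positivity : 0 < 1 / 2 / s ^ 2))
    (Set.mem_Ioi.2 (by positivity : 0 < 1 / 2 / r ^ 2)) (by gcongr)
  simp only [hscale hr, hscale hs, hpow hr, hpow hs]
  rw [ENNReal.ofReal_mul (by positivity), ENNReal.ofReal_mul (by positivity), ← smul_smul,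
    ← smul_smul, ← Measure.map_smul, ← Measure.map_smul (c := ENNReal.ofReal (_ ^ (-(ν / 2))))]
  gcongr
  fun_prop

theorem chiSquareMeasure_sqrt_le {t : ℝ} (hν : 0 < ν) (ht : 0 ≤ t) :
    chiSquareMeasure ν {w | √(w / ν) ≤ t} ≤
      ENNReal.ofReal ((ν / 2) ^ (ν / 2) / Real.Gamma (ν / 2 + 1) * t ^ ν) := by
  have hset : {w | √(w / ν) ≤ t} = Set.Iic (t ^ 2 * ν) := by
    ext w
    rw [Set.mem_ofPred_eq, Real.sqrt_le_left ht, div_le_iff₀ hν, Set.mem_Iic]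
  have hpow : (1 / 2 * (t ^ 2 * ν)) ^ (ν / 2) = (ν / 2) ^ (ν / 2) * t ^ ν := by
    rw [show 1 / 2 * (t ^ 2 * ν) = ν / 2 * t ^ 2 by ring, Real.mul_rpow (by positivity)
      (by positivity), ← Real.rpow_natCast, ← Real.rpow_mul ht, Nat.cast_two,
      mul_div_cancel₀ _ two_ne_zero]
  rw [hset, chiSquareMeasure, div_mul_eq_mul_div, ← hpow]
  exact gammaMeasure_Iic_le (half_pos hν) one_half_pos.le (by positivity)

theorem monotoneOn_rpow_mul_real_prod_chiSquareMeasure {E : Type*} [MeasurableSpace E]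
    {κ : Measure E} [IsFiniteMeasure κ] (hν : 0 < ν) {A : Set (E × ℝ)} (hA : MeasurableSet A) :
    MonotoneOn (fun r : ℝ => r ^ ν *
      (κ.prod (chiSquareMeasure ν)).real {p | (p.1, r * √(p.2 / ν)) ∈ A}) (Set.Ioi 0) := by
  have := isProbabilityMeasure_chiSquareMeasure hν
  have heq {r : ℝ} (hr : 0 < r) :
      r ^ ν * (κ.prod (chiSquareMeasure ν)).real {p | (p.1, r * √(p.2 / ν)) ∈ A} =
      (κ.prod (ENNReal.ofReal (r ^ ν) •
        (chiSquareMeasure ν).map fun w => r * √(w / ν))).real A := by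
    have hprod := Measure.map_prod_map κ (chiSquareMeasure ν) measurable_id
      (g := fun w => r * √(w / ν)) (by fun_prop)
    rw [Measure.map_id] at hprod
    rw [Measure.prod_smul_right, hprod, measureReal_ennreal_smul_apply,
      map_measureReal_apply (by fun_prop) hA, ENNReal.toReal_ofReal (by positivity)]
    rfl
  intro r hr s hs hrs
  simp only [heq hr, heq hs]
  refine ENNReal.toReal_mono ?_
    (Measure.prod_mono le_rfl (monotoneOn_rpow_smul_chiSquareMeasure_map_sqrt hν hr hs hrs) A)
  rw [Measure.prod_smul_right]
  exact ENNReal.mul_ne_top ENNReal.ofReal_ne_top (measure_ne_top _ A)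

end ChiSquare

section StudentT

variable {ν : ℝ}

theorem isProbabilityMeasure_studentTMeasure (hν : 0 < ν) :
    IsProbabilityMeasure (studentTMeasure ν) := by
  have := isProbabilityMeasure_chiSquareMeasure hν
  exact Measure.isProbabilityMeasure_map (by fun_prop)

theorem isProbabilityMeasure_multivariateTMeasure {N : ℕ} (S : Matrix (Fin N) (Fin N) ℝ)
    (hν : 0 < ν) : IsProbabilityMeasure (multivariateTMeasure ν S) := by
  have := isProbabilityMeasure_chiSquareMeasure hν
  exact Measure.isProbabilityMeasure_map (by fun_prop)

theorem div_le_neg_iff_div_mul_le_neg_one {𝕜 : Type*} [Field 𝕜] [LinearOrder 𝕜]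
    [IsStrictOrderedRing 𝕜] {r : 𝕜} (hr : 0 < r) (x y : 𝕜) : x / y ≤ -r ↔ x / (r * y) ≤ -1 := by
  rw [mul_comm, ← div_div, div_le_iff₀ hr, neg_one_mul]

theorem monotoneOn_rpow_mul_studentTMeasure_Iic_neg (hν : 0 < ν) :
    MonotoneOn (fun r : ℝ => r ^ ν * (studentTMeasure ν).real (Set.Iic (-r))) (Set.Ioi 0) := by
  have hA : MeasurableSet {q : ℝ × ℝ | q.1 / q.2 ≤ -1} :=
    measurableSet_le (by fun_prop) measurable_const
  refine (monotoneOn_rpow_mul_real_prod_chiSquareMeasure (κ := gaussianReal 0 1) hν hA).congr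
    fun r hr => ?_
  dsimp only
  rw [studentTMeasure, map_measureReal_apply (by fun_prop) measurableSet_Iic]
  congr 2 with p
  exact (div_le_neg_iff_div_mul_le_neg_one (Set.mem_Ioi.1 hr) _ _).symm

theorem monotoneOn_rpow_mul_multivariateTMeasure_Iic_neg {N : ℕ} (S : Matrix (Fin N) (Fin N) ℝ)
    (hν : 0 < ν) :
    MonotoneOn (fun r : ℝ => r ^ ν * (multivariateTMeasure ν S).real (Set.Iic fun _ => -r))
      (Set.Ioi 0) := by
  have hA : MeasurableSet {q : EuclideanSpace ℝ (Fin N) × ℝ | ∀ i, q.1 i / q.2 ≤ -1} := by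
    rw [Set.ofPred_forall]
    exact .iInter fun i => measurableSet_le (by fun_prop) measurable_const
  refine (monotoneOn_rpow_mul_real_prod_chiSquareMeasure (κ := multivariateGaussian 0 S) hν
    hA).congr fun r hr => ?_
  dsimp only
  rw [multivariateTMeasure, map_measureReal_apply (by fun_prop) measurableSet_Iic]
  congr 2 with p
  exact forall_congr' fun i => (div_le_neg_iff_div_mul_le_neg_one (Set.mem_Ioi.1 hr) _ _).symm

theorem integrable_abs_rpow_gaussianReal (μ : ℝ) (v : NNReal) {s : ℝ} (hs : 0 ≤ s) :
    Integrable (fun z : ℝ => |z| ^ s) (gaussianReal μ v) := by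
  simpa [hs] using (memLp_id_gaussianReal (μ := μ) (v := v) s.toNNReal).integrable_norm_rpow'

theorem rpow_mul_studentTMeasure_Iic_neg_le {r : ℝ} (hν : 0 < ν) (hr : 0 < r) :
    r ^ ν * (studentTMeasure ν).real (Set.Iic (-r)) ≤
      (ν / 2) ^ (ν / 2) / Real.Gamma (ν / 2 + 1) * ∫ z, |z| ^ ν ∂gaussianReal 0 1 := by
  have := isProbabilityMeasure_chiSquareMeasure hν
  have : 0 < Real.Gamma (ν / 2 + 1) := Real.Gamma_pos_of_pos (by positivity)
  set C := (ν / 2) ^ (ν / 2) / Real.Gamma (ν / 2 + 1)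
  have : 0 ≤ C := by positivity
  have hsubset (z : ℝ) : {w | z / √(w / ν) ≤ -r} ⊆ {w | √(w / ν) ≤ |z| / r} := fun w hw => by
    have hle : r ≤ |z| / √(w / ν) := by
      rw [← abs_of_nonneg (Real.sqrt_nonneg (w / ν)), ← abs_div]
      exact le_abs.2 (.inr (le_neg_of_le_neg hw))
    exact (le_div_iff₀' hr).2 (mul_le_of_le_div₀ (abs_nonneg z) (Real.sqrt_nonneg _) hle)
  have htail : studentTMeasure ν (Set.Iic (-r)) ≤
      ENNReal.ofReal (C / r ^ ν * ∫ z, |z| ^ ν ∂gaussianReal 0 1) := by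
    rw [studentTMeasure, Measure.map_apply (by fun_prop) measurableSet_Iic,
      Measure.prod_apply (measurableSet_Iic.preimage (by fun_prop)), ← integral_const_mul,
      ofReal_integral_eq_lintegral_ofReal
        ((integrable_abs_rpow_gaussianReal 0 1 hν.le).const_mul _)
        (ae_of_all _ fun z => by positivity)]
    refine lintegral_mono fun z => ((measure_mono (hsubset z)).trans
      (chiSquareMeasure_sqrt_le hν (by positivity))).trans_eq ?_
    rw [Real.div_rpow (abs_nonneg z) hr.le, div_mul_eq_mul_div C, mul_div_assoc C]
  have hreal := ENNReal.toReal_le_of_le_ofReal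
    (mul_nonneg (by positivity) (integral_nonneg fun z => by positivity)) htail
  rwa [div_mul_eq_mul_div, le_div_iff₀' (by positivity)] at hreal

theorem studentTMeasure_eq_zero_iff (hν : 0 < ν) {A : Set ℝ} (hA : MeasurableSet A) :
    studentTMeasure ν A = 0 ↔ volume A = 0 := by
  have := isProbabilityMeasure_chiSquareMeasure hν
  have hpos : ∀ᵐ w ∂chiSquareMeasure ν, 0 < w := ae_gammaMeasure_pos _ _
  have hmeas : MeasurableSet ((fun p : ℝ × ℝ => p.1 / √(p.2 / ν)) ⁻¹' A) :=
    hA.preimage (by fun_prop)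
  have hslice {w : ℝ} (hw : 0 < w) :
      gaussianReal 0 1 ((fun z => z / √(w / ν)) ⁻¹' A) = 0 ↔ volume A = 0 := by
    have hvar : 1 / NNReal.mk (√(w / ν) ^ 2) (sq_nonneg _) ≠ 0 :=
      one_div_ne_zero (NNReal.coe_ne_zero.1 (by rw [NNReal.coe_mk]; positivity))
    rw [← Measure.map_apply (by fun_prop) hA, gaussianReal_map_div_const]
    exact ⟨fun h => gaussianReal_absolutelyContinuous' _ hvar h,
      fun h => gaussianReal_absolutelyContinuous _ hvar h⟩
  rw [studentTMeasure, Measure.map_apply (by fun_prop) hA, Measure.prod_apply_symm hmeas,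
    lintegral_eq_zero_iff (measurable_measure_prodMk_right hmeas)]
  refine ⟨fun h => ?_, fun h => hpos.mono fun w hw => (hslice hw).2 h⟩
  obtain ⟨w, hzero, hw⟩ := (h.and hpos).exists
  exact (hslice hw).1 hzero

theorem nullSingletonClass_studentTMeasure (hν : 0 < ν) :
    NullSingletonClass (studentTMeasure ν) :=
  ⟨fun x => (studentTMeasure_eq_zero_iff hν (measurableSet_singleton x)).2 Real.volume_singleton⟩

theorem studentTMeasure_real_Iic_pos (hν : 0 < ν) (x : ℝ) :
    0 < (studentTMeasure ν).real (Set.Iic x) := by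
  have := isProbabilityMeasure_studentTMeasure hν
  refine measureReal_nonneg.lt_of_ne' fun h => ?_
  have hvol := (studentTMeasure_eq_zero_iff hν measurableSet_Iic).1
    ((measureReal_eq_zero_iff (measure_ne_top _ _)).1 h)
  simp at hvol

end StudentT

section Quantile

theorem continuous_cdf (μ : Measure ℝ) [IsProbabilityMeasure μ] [NullSingletonClass μ] :
    Continuous (cdf μ) := by
  refine continuous_iff_continuousAt.2 fun x => ?_
  rw [(monotone_cdf μ).continuousAt_iff_leftLim_eq_rightLim, (cdf μ).rightLim_eq]
  have h := (cdf μ).measure_singleton x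
  rw [measure_cdf, measure_singleton, eq_comm, ENNReal.ofReal_eq_zero, sub_nonpos] at h
  exact le_antisymm ((monotone_cdf μ).leftLim_le le_rfl) h

theorem exists_isLeast_le_cdf (μ : Measure ℝ) [IsProbabilityMeasure μ] [NullSingletonClass μ]
    {p : ℝ} (hp : p ∈ Set.Ioo 0 1) : ∃ q, IsLeast {x | p ≤ cdf μ x} q ∧ cdf μ q = p := by
  obtain ⟨a, ha⟩ := ((tendsto_cdf_atBot μ).eventually_lt_const hp.1).exists
  obtain ⟨b, hb⟩ := ((tendsto_cdf_atTop μ).eventually_const_lt hp.2).exists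
  have hbdd : BddBelow {x | p ≤ cdf μ x} :=
    ⟨a, fun x hx => ((monotone_cdf μ).reflect_lt (ha.trans_le hx)).le⟩
  have hleast := (isClosed_le continuous_const (continuous_cdf μ)).isLeast_csInf ⟨b, hb.le⟩ hbdd
  obtain ⟨x, hx⟩ := mem_range_of_exists_le_of_exists_ge (continuous_cdf μ) ⟨a, ha.le⟩ ⟨b, hb.le⟩
  exact ⟨_, hleast, le_antisymm ((monotone_cdf μ (hleast.2 hx.ge)).trans hx.le) hleast.1⟩

variable {ν p : ℝ}

theorem tQuantile_mono (ν : ℝ) : Monotone (tQuantile ν) := by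
  intro p q hpq
  refine sInf_le_sInf ?_
  rintro _ ⟨x, rfl, hx⟩
  exact ⟨x, rfl, hpq.trans hx⟩

theorem exists_tQuantile_eq_coe (hν : 0 < ν) (hp : p ∈ Set.Ioo 0 1) :
    ∃ q : ℝ, tQuantile ν p = q ∧ (studentTMeasure ν).real (Set.Iic q) = p := by
  have := isProbabilityMeasure_studentTMeasure hν
  have := nullSingletonClass_studentTMeasure hν
  obtain ⟨q, hleast, hq⟩ := exists_isLeast_le_cdf (studentTMeasure ν) hp
  simp only [cdf_eq_real] at hleast hq
  refine ⟨q, IsLeast.csInf_eq ⟨⟨q, rfl, hleast.1⟩, ?_⟩, hq⟩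
  rintro _ ⟨x, rfl, hx⟩
  exact EReal.coe_le_coe_iff.2 (hleast.2 hx)

/-- The level `r` with `Pr(T ≤ -r) = p` for a Student `t` variable `T`: minus the quantile of
order `p`, as a real number. It carries the small-`p` asymptotics of the copula; outside
`0 < p < 1` the quantile may be infinite and the value is junk. -/
noncomputable def lowerTailLevel (ν p : ℝ) : ℝ := -(tQuantile ν p).toReal

theorem tQuantile_eq_neg_lowerTailLevel (hν : 0 < ν) (hp : p ∈ Set.Ioo 0 1) :
    tQuantile ν p = ↑(-lowerTailLevel ν p) := by
  obtain ⟨q, hq, -⟩ := exists_tQuantile_eq_coe hν hp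
  rw [lowerTailLevel, hq, EReal.toReal_coe, neg_neg]

theorem studentTMeasure_real_Iic_neg_lowerTailLevel (hν : 0 < ν) (hp : p ∈ Set.Ioo 0 1) :
    (studentTMeasure ν).real (Set.Iic (-lowerTailLevel ν p)) = p := by
  obtain ⟨q, hq, hFq⟩ := exists_tQuantile_eq_coe hν hp
  rw [lowerTailLevel, hq, EReal.toReal_coe, neg_neg, hFq]

theorem antitoneOn_lowerTailLevel (hν : 0 < ν) :
    AntitoneOn (lowerTailLevel ν) (Set.Ioo 0 1) := by
  intro p hp q hq hpq
  have hle := tQuantile_mono ν hpq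
  rwa [tQuantile_eq_neg_lowerTailLevel hν hp, tQuantile_eq_neg_lowerTailLevel hν hq,
    EReal.coe_le_coe_iff, neg_le_neg_iff] at hle

theorem Ioo_studentTMeasure_real_Iic_subset (hν : 0 < ν) (x : ℝ) :
    Set.Ioo 0 ((studentTMeasure ν).real (Set.Iic x)) ⊆ Set.Ioo 0 1 := by
  have := isProbabilityMeasure_studentTMeasure hν
  exact Set.Ioo_subset_Ioo_right measureReal_le_one

theorem lowerTailLevel_pos (hν : 0 < ν)
    (hp : p ∈ Set.Ioo 0 ((studentTMeasure ν).real (Set.Iic 0))) : 0 < lowerTailLevel ν p := by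
  have := isProbabilityMeasure_studentTMeasure hν
  by_contra! hle
  refine hp.2.not_ge ?_
  rw [← studentTMeasure_real_Iic_neg_lowerTailLevel hν
    (Ioo_studentTMeasure_real_Iic_subset hν 0 hp)]
  exact measureReal_mono (Set.Iic_subset_Iic.2 (neg_nonneg.2 hle))

theorem antitoneOn_lowerTailLevel_rpow_mul (hν : 0 < ν) :
    AntitoneOn (fun p => lowerTailLevel ν p ^ ν * p)
      (Set.Ioo 0 ((studentTMeasure ν).real (Set.Iic 0))) := by
  have hsub := Ioo_studentTMeasure_real_Iic_subset hν 0
  refine ((monotoneOn_rpow_mul_studentTMeasure_Iic_neg hν).comp_AntitoneOn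
    ((antitoneOn_lowerTailLevel hν).mono hsub) fun p => lowerTailLevel_pos hν).congr
    fun p hp => ?_
  simp only [Function.comp_apply, studentTMeasure_real_Iic_neg_lowerTailLevel hν (hsub hp)]

theorem exists_isEquivalent_lowerTailLevel_rpow (hν : 0 < ν) :
    ∃ ℓ : ℝ, 0 < ℓ ∧ (fun p => lowerTailLevel ν p ^ ν) ~[𝓝[>] 0] fun p => ℓ / p := by
  set s := Set.Ioo 0 ((studentTMeasure ν).real (Set.Iic 0))
  set f : ℝ → ℝ := fun p => lowerTailLevel ν p ^ ν * p
  have hne : s.Nonempty := Set.nonempty_Ioo.2 (studentTMeasure_real_Iic_pos hν 0)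
  have hbdd : BddAbove (f '' s) := by
    refine ⟨(ν / 2) ^ (ν / 2) / Real.Gamma (ν / 2 + 1) * ∫ z, |z| ^ ν ∂gaussianReal 0 1, ?_⟩
    rintro _ ⟨p, hp, rfl⟩
    have hbound := rpow_mul_studentTMeasure_Iic_neg_le hν (lowerTailLevel_pos hν hp)
    rwa [studentTMeasure_real_Iic_neg_lowerTailLevel hν
      (Ioo_studentTMeasure_real_Iic_subset hν 0 hp)] at hbound
  have hlim : Tendsto f (𝓝[>] 0) (𝓝 (sSup (f '' s))) :=
    (antitoneOn_lowerTailLevel_rpow_mul hν).tendsto_nhdsWithin_Ioo_right hne hbdd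
  have hpos : 0 < sSup (f '' s) := by
    obtain ⟨p, hp⟩ := hne
    exact (mul_pos (Real.rpow_pos_of_pos (lowerTailLevel_pos hν hp) ν) hp.1).trans_le
      (le_csSup hbdd (Set.mem_image_of_mem f hp))
  refine ⟨_, hpos, (((isEquivalent_const_iff_tendsto hpos.ne').2 hlim).div
    (IsEquivalent.refl (u := id))).congr_left ?_⟩
  filter_upwards [self_mem_nhdsWithin] with p hp
  exact mul_div_cancel_right₀ _ (ne_of_gt hp)

end Quantile

section Copula

theorem isEquivalent_comp_of_monotoneOn_of_antitoneOn_mul {α ι : Type*} [LinearOrder ι]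
    {l : Filter α} {C ρ : ι → ℝ} {s : Set ι} (hC : MonotoneOn C s) (hC0 : ∀ p ∈ s, 0 ≤ C p)
    (hρ : ∀ p ∈ s, 0 < ρ p) (hρC : AntitoneOn (fun p => ρ p * C p) s) {u v : α → ι}
    (hu : ∀ᶠ a in l, u a ∈ s) (hv : ∀ᶠ a in l, v a ∈ s) (h : (ρ ∘ u) ~[l] (ρ ∘ v)) :
    (C ∘ v) ~[l] (C ∘ u) := by
  have hbound {p q : ι} (hp : p ∈ s) (hq : q ∈ s) : |C q - C p| ≤ |ρ p / ρ q - 1| * C p := by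
    rw [← abs_of_nonneg (hC0 p hp), ← abs_mul, sub_one_mul, div_mul_eq_mul_div,
      abs_of_nonneg (hC0 p hp)]
    rcases le_total p q with hpq | hqp
    · have hle : C q ≤ ρ p * C p / ρ q := (le_div_iff₀' (hρ q hq)).2 (hρC hp hq hpq)
      exact abs_le_abs_of_nonneg (sub_nonneg.2 (hC hp hq hpq)) (by linarith)
    · have hle : ρ p * C p / ρ q ≤ C q := (div_le_iff₀' (hρ q hq)).2 (hρC hq hp hqp)
      exact abs_le_abs_of_nonpos (sub_nonpos.2 (hC hq hp hqp)) (by linarith)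
  have hratio : Tendsto (ρ ∘ u / ρ ∘ v) l (𝓝 1) :=
    (isEquivalent_iff_tendsto_one (hv.mono fun a ha => (hρ _ ha).ne')).1 h
  refine isLittleO_iff.2 fun c hc => ?_
  filter_upwards [hu, hv, Metric.tendsto_nhds.1 hratio c hc] with a hua hva hca
  rw [Pi.sub_apply, Real.norm_eq_abs, Function.comp_apply, Function.comp_apply,
    Real.norm_of_nonneg (hC0 _ hua)]
  exact (hbound hua hva).trans (mul_le_mul_of_nonneg_right hca.le (hC0 _ hua))

variable {N : ℕ} (S : Matrix (Fin N) (Fin N) ℝ) {ν : ℝ}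

theorem tCopula_const_eq {p : ℝ} (hν : 0 < ν) (hp : p ∈ Set.Ioo 0 1) :
    tCopula ν S (fun _ => p) =
      (multivariateTMeasure ν S).real (Set.Iic fun _ => -lowerTailLevel ν p) := by
  simp only [tCopula, multivariateTCDF, tQuantile_eq_neg_lowerTailLevel hν hp,
    EReal.coe_le_coe_iff]
  rfl

theorem monotoneOn_tCopula_const (hν : 0 < ν) :
    MonotoneOn (fun p => tCopula ν S fun _ => p) (Set.Ioo 0 1) := by
  have := isProbabilityMeasure_multivariateTMeasure S hν
  intro p hp q hq hpq
  simp only [tCopula_const_eq S hν hp, tCopula_const_eq S hν hq]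
  exact measureReal_mono
    (Set.Iic_subset_Iic.2 fun _ => neg_le_neg (antitoneOn_lowerTailLevel hν hp hq hpq))

theorem antitoneOn_lowerTailLevel_rpow_mul_tCopula_const (hν : 0 < ν) :
    AntitoneOn (fun p => lowerTailLevel ν p ^ ν * tCopula ν S fun _ => p)
      (Set.Ioo 0 ((studentTMeasure ν).real (Set.Iic 0))) := by
  have hsub := Ioo_studentTMeasure_real_Iic_subset hν 0
  refine ((monotoneOn_rpow_mul_multivariateTMeasure_Iic_neg S hν).comp_AntitoneOn
    ((antitoneOn_lowerTailLevel hν).mono hsub) fun p => lowerTailLevel_pos hν).congr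
    fun p hp => ?_
  simp only [Function.comp_apply, tCopula_const_eq S hν (hsub hp)]

theorem isEquivalent_tCopula_const {α : Type*} {l : Filter α} {u v : α → ℝ} (hν : 0 < ν)
    (hu : Tendsto u l (𝓝[>] 0)) (hv : Tendsto v l (𝓝[>] 0)) (h : v ~[l] u) :
    (fun a => tCopula ν S fun _ => v a) ~[l] fun a => tCopula ν S fun _ => u a := by
  obtain ⟨ℓ, -, hlevel⟩ := exists_isEquivalent_lowerTailLevel_rpow hν
  have hs := Ioo_mem_nhdsGT (studentTMeasure_real_Iic_pos hν 0)
  refine isEquivalent_comp_of_monotoneOn_of_antitoneOn_mul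
    ((monotoneOn_tCopula_const S hν).mono (Ioo_studentTMeasure_real_Iic_subset hν 0))
    (fun _ _ => measureReal_nonneg)
    (fun p hp => Real.rpow_pos_of_pos (lowerTailLevel_pos hν hp) ν)
    (antitoneOn_lowerTailLevel_rpow_mul_tCopula_const S hν) (hu hs) (hv hs) ?_
  calc (fun p => lowerTailLevel ν p ^ ν) ∘ u
      ~[l] fun a => ℓ / u a := hlevel.comp_tendsto hu
    _ ~[l] fun a => ℓ / v a := IsEquivalent.refl.div h.symm
    _ ~[l] (fun p => lowerTailLevel ν p ^ ν) ∘ v := (hlevel.comp_tendsto hv).symm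

end Copula

theorem corollary1_general {Ω : Type*} [MeasurableSpace Ω] (P : Measure Ω) [IsProbabilityMeasure P]
    {K : ℕ} (αc : ℝ) (αp : Fin K → ℝ) (hαp : ∀ j, 0 ≤ αp j) (hα : αc + ∑ j, αp j = 1)
    (k : Fin K) (L : ℝ) (hL : 0 < L) (θc θp : ℝ) (hθc : 0 < θc)
    (hfc : (1 - αc) * θc < αc) (hfp : (1 - αc - αp k) * θp < αp k)
    {N : ℕ} [NeZero N] (h : Fin N → Ω → ℂ) (hray : ∀ n, IsRayleighFading P (h n))
    (gbar : ℝ) (hgbar : ∀ n, ∫ ω, channelGain (h n) ω ∂P = gbar)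
    (ν : ℝ) (hν : 0 < ν) (S : Matrix (Fin N) (Fin N) ℝ)
    (hcop : HasTCopula P ν S fun n => channelGain (h n)) :
    (∀ snr : ℝ, 0 < snr → outageProb P αc αp k L θc θp h snr =
      tCopula ν S fun _ => 1 - Real.exp (-(gainThreshold αc (αp k) L θc θp snr / gbar))) ∧
    (∀ n, (fun snr : ℝ => P.real {ω | channelGain (h n) ω ≤ gainThreshold αc (αp k) L θc θp snr})
      ~[atTop] fun snr => gainThreshold αc (αp k) L θc θp snr / gbar) ∧
    (fun snr : ℝ => outageProb P αc αp k L θc θp h snr) ~[atTop]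
      fun snr => tCopula ν S fun _ => gainThreshold αc (αp k) L θc θp snr / gbar := by
  set g := gainThreshold αc (αp k) L θc θp
  have hgbar_pos : 0 < gbar := hgbar 0 ▸ (hray 0).integral_channelGain_pos
  have hmarginal (n) {snr : ℝ} (hsnr : 0 < snr) :
      P.real {ω | channelGain (h n) ω ≤ g snr} = 1 - Real.exp (-(g snr / gbar)) := by
    rw [(hray n).real_channelGain_le (gainThreshold_pos hL hθc hfc hsnr).le, hgbar n]
  have hout (snr : ℝ) (hsnr : 0 < snr) : outageProb P αc αp k L θc θp h snr =
      tCopula ν S fun _ => 1 - Real.exp (-(g snr / gbar)) := by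
    rw [outageProb_eq_real_forall_channelGain_le
      (fun n => (hray n).hasLaw_channelGain.aemeasurable) hαp hα hL hfc hfp hsnr,
      hcop fun _ => g snr]
    simp only [hmarginal _ hsnr]
  have hlim : Tendsto (fun snr => g snr / gbar) atTop (𝓝[>] 0) :=
    tendsto_gainThreshold_div_atTop hL hθc hfc hgbar_pos
  have hexp : (fun snr => 1 - Real.exp (-(g snr / gbar))) ~[atTop] fun snr => g snr / gbar :=
    isEquivalent_one_sub_exp_neg.comp_tendsto (hlim.mono_right nhdsWithin_le_nhds)
  refine ⟨hout, fun n => hexp.congr_left ?_, (isEquivalent_tCopula_const S hν hlim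
    (tendsto_one_sub_exp_neg.comp hlim) hexp).congr_left ?_⟩
  · exact (eventually_gt_atTop 0).mono fun snr hsnr => (hmarginal n hsnr).symm
  · exact (eventually_gt_atTop 0).mono fun snr hsnr => (hout snr hsnr).symm

theorem corollary1
    {Ω : Type*} [MeasurableSpace Ω] (P : Measure Ω) [IsProbabilityMeasure P]
    -- power allocation among the common message and the private messages of the `K` users
    {K : ℕ} (αc : ℝ) (αp : Fin K → ℝ) (hαp : ∀ j, 0 ≤ αp j) (hα : αc + ∑ j, αp j = 1)
    -- the user, the path loss exponent, the positions of the base station and of the user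
    (k : Fin K) (β : ℝ) (hβ : 2 < β) (x₀ x : EuclideanSpace ℝ (Fin 3)) (hx : x₀ ≠ x)
    -- SINR thresholds, attainable in the absence of noise
    (θc θp : ℝ) (hθc : 0 < θc) (hθp : 0 < θp)
    (hfc : (1 - αc) * θc < αc) (hfp : (1 - αc - αp k) * θp < αp k)
    -- the ports of the user: Rayleigh fading of mean power `gbar`, coupled by a `t` copula
    {N : ℕ} [NeZero N] (h : Fin N → Ω → ℂ) (hray : ∀ n, IsRayleighFading P (h n))
    (gbar : ℝ) (hgbar : ∀ n, ∫ ω, channelGain (h n) ω ∂P = gbar)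
    (ν : ℝ) (hν : 0 < ν) (S : Matrix (Fin N) (Fin N) ℝ) (hS : IsCorrelationMatrix S)
    (hcop : HasTCopula P ν S fun n => channelGain (h n)) :
    -- the outage probability is the copula at the exponential marginals
    (∀ snr : ℝ, 0 < snr →
      outageProb P αc αp k (pathLoss β x₀ x) θc θp h snr =
        multivariateTCDF ν S fun _ => tQuantile ν
          (1 - Real.exp (-(gainThreshold αc (αp k) (pathLoss β x₀ x) θc θp snr / gbar)))) ∧
    -- first-order behaviour of the marginal distribution functions at high SNR
    (∀ n, (fun snr : ℝ => P.real {ω | channelGain (h n) ω ≤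
          gainThreshold αc (αp k) (pathLoss β x₀ x) θc θp snr}) ~[atTop]
        fun snr => gainThreshold αc (αp k) (pathLoss β x₀ x) θc θp snr / gbar) ∧
    -- the outage probability is asymptotically equivalent to the copula at the first-order terms
    (fun snr : ℝ => outageProb P αc αp k (pathLoss β x₀ x) θc θp h snr) ~[atTop]
      fun snr => multivariateTCDF ν S fun _ => tQuantile ν
        (gainThreshold αc (αp k) (pathLoss β x₀ x) θc θp snr / gbar) :=
  corollary1_general P αc αp hαp hα k _ (pathLoss_pos β hx) θc θp hθc hfc hfp h hray gbar hgbar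
    ν hν S hcop
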